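/- **Setting.** Let $\Omega, B\subset\mathbb R^2$ be bounded open polygonal sets, $B\neq\emptyset$, with conforming triangulations $\mathcal T_h^\Omega$, $\mathcal T_h^B$ (finitely many nondegenerate closed triangles, two distinct ones meeting exactly in the convex hull of their common vertices; the set is the interior of their union). Let $\mathcal T_{h/2}^\Omega$ be the refinement of $\mathcal T_h^\Omega$ obtained by joining the edge midpoints of each triangle. Define $$V_h=\{v\in H^1_0(\Omega)^2\cap C(\overline\Omega)^2: v|_T\in P_1(T)^2\ \forall T\in\mathcal T^\Omega_{h/2}\},\qquad Q_h=\{q\in L^2_0(\Omega)\cap H^1(\Omega)\cap C(\overline\Omega): q|_T\in P_1(T)\ \forall T\in\mathcal T^\Omega_h\},$$ $$S_h=\Lambda_h=\{w\in H^1(B)^2\cap C(\overline B)^2: w|_T\in P_1(T)^2\ \forall T\in\mathcal T_h^B\},\qquad V_{0,h}=\{v\in V_h:(\operatorname{div}v,q)_\Omega=0\ \ \forall q\in Q_h\}.$$ Let $\bar X:\overline B\to\Omega$ be Lipschitz and invertible onto its image with Lipschitz inverse. Let two quadrature rules on the reference triangle $\hat T$, with nodes in $\hat T$ and weights $\omega^0_k$,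 respectively $\omega^1_k$, be given, and let $s^0_k$, $s^1_k$ be the images of the nodes in $T\in\mathcal T_h^B$ under the affine map $\hat T\to T$. For $\mu_h\in\Lambda_h$, $v_h\in V_h$, $Y_h\in S_h$ put $$c_{0,h}(\mu_h,v_h(\bar X)-Y_h)=\sum_{T\in\mathcal T^B_h}|T|\sum_k\omega^0_k\,\mu_h(s^0_k)\cdot\big(v_h(\bar X(s^0_k))-Y_h(s^0_k)\big),$$ $$c_{1,h}(\mu_h,v_h(\bar X)-Y_h)=c_{0,h}(\mu_h,v_h(\bar X)-Y_h)+\sum_{T\in\mathcal T^B_h}|T|\sum_k\omega^1_k\,\nabla\mu_h(s^1_k):\big(\nabla v_h(\bar X(s_k^1))\,\nabla\bar X(s_k^1)-\nabla Y_h(s^1_k)\big),$$ where $\nabla\mu_h,\nabla Y_h,\nabla\bar X$ are the gradients of the restrictions to $T$ (with the convention $\nabla\bar X(s)=0$ where $\bar X|_T$ is not differentiable; this does not occur if $\bar X$ is affine on $T$), and $\nabla v_h$ at $\bar X(s_k^1)$ is the gradient on an arbitrarily prescribed triangle $K\in\mathcal T^\Omega_{h/2}$, depending on $T$ and $k$,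 with $\bar X(s_k^1)\in\overline{\bar X(\operatorname{int}T)\cap\operatorname{int}K}$. Finally $\|\mu_h\|_{\Lambda_0}$ is the norm of the functional $Y\mapsto(\mu_h,Y)_B$ in the dual of $H^1(B)^2$, and $\|\mu_h\|_{\Lambda_1}=\|\mu_h\|_{1,B}$. **Statement.** For every $C_0>0$ there is a constant $\beta_0>0$, depending only on $C_0$ (in particular not on the meshes), such that in every setting as above the following holds. Assume that the first quadrature rule (weights $\omega^0_k$) is exact for polynomials of degree at most $2$, that the second one (weights $\omega^1_k$) is exact for constants, and that the $L^2(B)$ projection $\Pi$ onto $S_h$ is $H^1$-stable: $\|\Pi Y\|_{1,B}\le C_0\|Y\|_{1,B}$ for all $Y\in H^1(B)^2$. Then, for both $\ell=0$ and $\ell=1$, $$\sup_{0\ne(v_h,Y_h)\in V_{0,h}\times S_h}\frac{c_{\ell,h}(\mu_h,v_h(\bar X)-Y_h)}{\big(\|v_h\|_{1,\Omega}^2+\|Y_h\|_{1,B}^2\big)^{1/2}}\ \ge\ \beta_0\,\|\mu_h\|_{\Lambda_\ell}\qquad\forall\mu_h\in\Lambda_h .$$ -/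

import Mathlib

open MeasureTheory Set
open scoped ContDiff InnerProductSpace

noncomputable section

namespace FSI

/-- The Euclidean plane, with its Euclidean norm and Lebesgue measure. -/
abbrev Plane : Type := EuclideanSpace ℝ (Fin 2)

/-- The `j`-th unit vector of the plane. -/
def unitVec (j : Fin 2) : Plane := EuclideanSpace.single j (1 : ℝ)

/-! ### The Sobolev spaces `H¹(D)` and `H¹₀(D)` -/

section Sobolev

variable (D : Set Plane) (F : Type) [NormedAddCommGroup F] [InnerProductSpace ℝ F]

/-- `L²(D; F)`. -/
abbrev L2 : Type := Lp F 2 ((volume : Measure Plane).restrict D)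

/-- Values of gradients of `F`-valued functions: the pair `(∂₁u, ∂₂u)`, with the
Euclidean (Frobenius) norm. -/
abbrev GradVal : Type := PiLp 2 (fun _ : Fin 2 => F)

/-- The Hilbert space `L²(D; F) × L²(D; F)²`, whose inner product is the sum of those of the
factors. -/
abbrev L2Pair : Type := WithLp 2 (L2 D F × L2 D (GradVal F))

variable {F}

/-- `φ` is a real test function on `D`: smooth, with compact support contained in `D`. -/
structure IsTestFun (φ : Plane → F) : Prop where
  smooth : ContDiff ℝ ∞ φ
  compact : HasCompactSupport φ
  support : tsupport φ ⊆ D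

/-- `G = (G₁, G₂)` is the weak gradient of `u` on `D`. -/
def IsWeakGrad (u : Plane → F) (G : Plane → GradVal F) : Prop :=
  ∀ φ : Plane → ℝ, IsTestFun D φ → ∀ j : Fin 2,
    ∫ x in D, (fderiv ℝ φ x (unitVec j)) • u x = - ∫ x in D, φ x • G x j

variable {D}

theorem IsTestFun.memLp {φ : Plane → ℝ} (h : IsTestFun D φ) :
    MemLp φ 2 ((volume : Measure Plane).restrict D) :=
  (h.smooth.continuous.memLp_of_hasCompactSupport (μ := volume) h.compact).restrict D

theorem IsTestFun.memLp_fderiv {φ : Plane → ℝ} (h : IsTestFun D φ) (j : Fin 2) :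
    MemLp (fun x => fderiv ℝ φ x (unitVec j)) 2 ((volume : Measure Plane).restrict D) := by
  have hc : Continuous (fun x => fderiv ℝ φ x (unitVec j)) :=
    (h.smooth.continuous_fderiv (by simp)).clm_apply continuous_const
  have hs : HasCompactSupport (fun x => fderiv ℝ φ x (unitVec j)) :=
    h.compact.fderiv_apply (𝕜 := ℝ) (unitVec j)
  exact (hc.memLp_of_hasCompactSupport (μ := volume) hs).restrict D

theorem integrable_smul_L2 {φ : Plane → ℝ}
    (h : MemLp φ 2 ((volume : Measure Plane).restrict D)) {u : Plane → F}
    (hu : MemLp u 2 ((volume : Measure Plane).restrict D)) :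
    Integrable (fun x => φ x • u x) ((volume : Measure Plane).restrict D) :=
  memLp_one_iff_integrable.1 (hu.smul h)

theorem memLp_grad_apply (G : L2 D (GradVal F)) (j : Fin 2) :
    MemLp (fun x => G x j) 2 ((volume : Measure Plane).restrict D) :=
  (PiLp.proj (𝕜 := ℝ) 2 (fun _ : Fin 2 => F) j).comp_memLp G

variable (D F)

/-- The Sobolev space `H¹(D; F)`: the square integrable functions with square integrable weak
gradient, each stored with its weak gradient. As a subspace of `L²(D; F) × L²(D; F)²` it carries
the inner product `(u, w)_D + (∇u, ∇w)_D` and the norm `‖·‖_{1,D}`. -/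
def H1 : Submodule ℝ (L2Pair D F) where
  carrier := {p | IsWeakGrad D p.fst p.snd}
  zero_mem' := by
    intro φ _ j
    have h1 := Lp.coeFn_zero F 2 ((volume : Measure Plane).restrict D)
    have h2 := Lp.coeFn_zero (GradVal F) 2 ((volume : Measure Plane).restrict D)
    have e1 : ∫ x in D, (fderiv ℝ φ x (unitVec j)) • (0 : L2 D F) x = 0 := by
      rw [← integral_zero Plane F (μ := (volume : Measure Plane).restrict D)]
      refine integral_congr_ae ?_
      filter_upwards [h1] with x hx
      rw [hx]; simp
    have e2 : ∫ x in D, φ x • (0 : L2 D (GradVal F)) x j = 0 := by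
      rw [← integral_zero Plane F (μ := (volume : Measure Plane).restrict D)]
      refine integral_congr_ae ?_
      filter_upwards [h2] with x hx
      rw [hx]; simp
    simp only [WithLp.zero_fst, WithLp.zero_snd]
    rw [e1, e2, neg_zero]
  add_mem' := by
    intro p q hp hq φ hφ j
    have h1 := Lp.coeFn_add p.fst q.fst
    have h2 := Lp.coeFn_add p.snd q.snd
    have e1 : ∫ x in D, (fderiv ℝ φ x (unitVec j)) • (p.fst + q.fst : L2 D F) x =
        (∫ x in D, (fderiv ℝ φ x (unitVec j)) • p.fst x) +
          ∫ x in D, (fderiv ℝ φ x (unitVec j)) • q.fst x := by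
      rw [← integral_add (integrable_smul_L2 (hφ.memLp_fderiv j) (Lp.memLp _))
        (integrable_smul_L2 (hφ.memLp_fderiv j) (Lp.memLp _))]
      refine integral_congr_ae ?_
      filter_upwards [h1] with x hx
      rw [hx]; simp
    have e2 : ∫ x in D, φ x • (p.snd + q.snd : L2 D (GradVal F)) x j =
        (∫ x in D, φ x • p.snd x j) + ∫ x in D, φ x • q.snd x j := by
      rw [← integral_add (integrable_smul_L2 hφ.memLp (memLp_grad_apply _ j))
        (integrable_smul_L2 hφ.memLp (memLp_grad_apply _ j))]
      refine integral_congr_ae ?_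
      filter_upwards [h2] with x hx
      rw [hx]; simp
    simp only [WithLp.add_fst, WithLp.add_snd]
    rw [e1, e2, hp φ hφ j, hq φ hφ j, neg_add]
  smul_mem' := by
    intro c p hp φ hφ j
    have h1 := Lp.coeFn_smul c p.fst
    have h2 := Lp.coeFn_smul c p.snd
    have e1 : ∫ x in D, (fderiv ℝ φ x (unitVec j)) • (c • p.fst : L2 D F) x =
        c • ∫ x in D, (fderiv ℝ φ x (unitVec j)) • p.fst x := by
      rw [← integral_smul]
      refine integral_congr_ae ?_
      filter_upwards [h1] with x hx
      rw [hx]; simp [smul_comm c]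
    have e2 : ∫ x in D, φ x • (c • p.snd : L2 D (GradVal F)) x j =
        c • ∫ x in D, φ x • p.snd x j := by
      rw [← integral_smul]
      refine integral_congr_ae ?_
      filter_upwards [h2] with x hx
      rw [hx]; simp [smul_comm c]
    simp only [WithLp.smul_fst, WithLp.smul_snd]
    rw [e1, e2, hp φ hφ j, smul_neg]

variable {D F}

/-- The underlying `L²` function of an `H¹` function. -/
def H1.val (u : H1 D F) : L2 D F := (u : L2Pair D F).fst

/-- The weak gradient of an `H¹` function. -/
def H1.grad (u : H1 D F) : L2 D (GradVal F) := (u : L2Pair D F).snd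

variable (D F)

/-- `H¹₀(D; F)`: the closure in `H¹(D; F)` of the test functions on `D`. -/
def H1Zero : Set (H1 D F) :=
  closure {u | ∃ φ : Plane → F, IsTestFun D φ ∧
    H1.val u =ᵐ[(volume : Measure Plane).restrict D] φ}

/-- The continuous linear inclusion of `H¹(D; F)` into `L²(D; F)`. -/
def H1.toL2 : H1 D F →L[ℝ] L2 D F :=
  (WithLp.fstL 2 ℝ (L2 D F) (L2 D (GradVal F))).comp (H1 D F).subtypeL

variable {D F}

/-- The element `Y ↦ (m, Y)_D` of the dual of `H¹(D; F)` defined by an `L²` function `m`;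
its norm is the operator norm. -/
def l2Functional (m : L2 D F) : StrongDual ℝ (H1 D F) :=
  (innerSL ℝ m).comp (H1.toL2 D F)

end Sobolev

/-! ### Triangulations and finite element spaces -/

/-- The closed triangle with vertices `a 0, a 1, a 2`. -/
def tri (a : Fin 3 → Plane) : Set Plane := convexHull ℝ (range a)

/-- The family `vert` of triangles, given by their vertices, is a conforming triangulation of the
(polygonal, bounded, open) set `D`: the triangles are nondegenerate and have distinct vertex sets,
two of them meet exactly in the convex hull of their common vertices (nothing, a
vertex or an edge), and `D` is the interior of their union. -/
structure IsMesh {ι : Type} (D : Set Plane) (vert : ι → Fin 3 → Plane) : Prop where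
  nondegenerate : ∀ i, AffineIndependent ℝ (vert i)
  distinct : ∀ i j, i ≠ j → range (vert i) ≠ range (vert j)
  conforming : ∀ i j, i ≠ j →
    tri (vert i) ∩ tri (vert j) = convexHull ℝ (range (vert i) ∩ range (vert j))
  interior_union : interior (⋃ i, tri (vert i)) = D

/-- The refined family in which every triangle is cut into four by joining the midpoints of its
edges. -/
def refine {ι : Type} (vert : ι → Fin 3 → Plane) : ι × Fin 4 → Fin 3 → Plane :=
  fun p =>
    let a := vert p.1
    let m01 := midpoint ℝ (a 0) (a 1)
    let m02 := midpoint ℝ (a 0) (a 2)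
    let m12 := midpoint ℝ (a 1) (a 2)
    ![![a 0, m01, m02], ![m01, a 1, m12], ![m02, m12, a 2], ![m01, m12, m02]] p.2

/-- A finite element function: an `H¹(D; F)` function `toH1` that is affine on every closed triangle
of the mesh, stored together with its pointwise representative `toFun`. Since `toFun` is single
valued on the closed triangles, it is continuous on their union `closure D`; its values elsewhere
play no role. -/
structure FEFun {ι : Type} (D : Set Plane) (vert : ι → Fin 3 → Plane)
    (F : Type) [NormedAddCommGroup F] [InnerProductSpace ℝ F] where
  toFun : Plane → F
  toH1 : H1 D F
  isRep : H1.val toH1 =ᵐ[(volume : Measure Plane).restrict D] toFun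
  affineOn : ∀ i, ∃ A : Plane →ᵃ[ℝ] F, EqOn toFun A (tri (vert i))

/-- Elements of the multiplier space and of the solid space: vector valued, continuous and piecewise
affine on the mesh `vert` of `B`. -/
abbrev SolidFun {ι : Type} (B : Set Plane) (vert : ι → Fin 3 → Plane) : Type :=
  FEFun B vert Plane

/-- The discrete pressures `q_h` on the mesh `vert` of `Ω`: continuous, piecewise affine, with zero
mean. -/
def IsPressure {ι : Type} {Ω : Set Plane} {vert : ι → Fin 3 → Plane} (q : FEFun Ω vert ℝ) : Prop :=
  ∫ x in Ω, q.toFun x = 0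

/-- `v` (vector valued, continuous and piecewise affine on the refined mesh) lies in the discretely
divergence free velocity space `V_{0,h}`: it belongs to `H¹₀(Ω)²` and `(div v, q_h)_Ω = 0` for all
discrete pressures `q_h` on the coarse mesh. -/
structure IsDivFreeVelocity {ι : Type} {Ω : Set Plane} {vert : ι → Fin 3 → Plane}
    (v : FEFun Ω (refine vert) Plane) : Prop where
  zeroTrace : v.toH1 ∈ H1Zero Ω Plane
  divFree : ∀ q : FEFun Ω vert ℝ, IsPressure q →
    ∫ x in Ω, (∑ j : Fin 2, (H1.grad v.toH1 x j) j) * q.toFun x = 0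

/-- `P` is the `L²(B)` projection of `Y ∈ H¹(B)²` onto the solid finite element space. -/
def IsL2Projection {ι : Type} {B : Set Plane} {vert : ι → Fin 3 → Plane}
    (Y : H1 B Plane) (P : SolidFun B vert) : Prop :=
  ∀ Z : SolidFun B vert, ⟪H1.val Y - H1.val P.toH1, H1.val Z.toH1⟫_ℝ = 0

/-- The `L²` projection onto the solid finite element space is `H¹` stable with constant `C₀`. -/
def H1StableProjection {ι : Type} (B : Set Plane) (vert : ι → Fin 3 → Plane) (C₀ : ℝ) : Prop :=
  ∀ (Y : H1 B Plane) (P : SolidFun B vert), IsL2Projection Y P → ‖P.toH1‖ ≤ C₀ * ‖Y‖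

/-! ### Quadrature -/

/-- The vertices `(0,0), (1,0), (0,1)` of the reference triangle. -/
def refVert : Fin 3 → Plane := ![0, unitVec 0, unitVec 1]

/-- A quadrature rule on the reference triangle. -/
structure QuadRule where
  num : ℕ
  node : Fin num → Plane
  weight : Fin num → ℝ
  node_mem : ∀ k, node k ∈ tri refVert

/-- The rule is exact for the polynomials of total degree at most `m`: `∫_T̂ p = |T̂| ∑ₖ ωₖ p(ŝₖ)`. -/
def QuadRule.ExactOfDegree (Q : QuadRule) (m : ℕ) : Prop :=
  ∀ p : MvPolynomial (Fin 2) ℝ, p.totalDegree ≤ m →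
    ∫ x in tri refVert, MvPolynomial.eval (fun j => x j) p =
      volume.real (tri refVert) *
        ∑ k, Q.weight k * MvPolynomial.eval (fun j => Q.node k j) p

/-- The `k`-th node of the rule on the triangle with vertices `a`: the image of the
reference node under the affine map from the reference triangle. -/
def QuadRule.nodeOn (Q : QuadRule) (a : Fin 3 → Plane) (k : Fin Q.num) : Plane :=
  a 0 + Q.node k 0 • (a 1 - a 0) + Q.node k 1 • (a 2 - a 0)

/-- The Frobenius product `A : G`. -/
def frob (A G : Plane →L[ℝ] Plane) : ℝ := ∑ j : Fin 2, ⟪A (unitVec j), G (unitVec j)⟫_ℝ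

/-- The gradient at `x ∈ tri a` of the restriction of `w` to the closed triangle `tri a`. -/
def gradOn (a : Fin 3 → Plane) (w : Plane → Plane) (x : Plane) : Plane →L[ℝ] Plane :=
  fderivWithin ℝ w (tri a) x

/-! ### The inexact coupling -/

/-- The map `Xbar` of the solid reference domain into the fluid domain: Lipschitz, invertible with
Lipschitz inverse, and sending `closure B` into the open set `Ω`. -/
structure IsSolidMap (Ω B : Set Plane) (Xbar : Plane → Plane) : Prop where
  mapsTo : MapsTo Xbar (closure B) Ω
  lipschitz : ∃ L : ℝ, ∀ s ∈ closure B, ∀ t ∈ closure B, dist (Xbar s) (Xbar t) ≤ L * dist s t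
  lipschitz_inverse :
    ∃ L : ℝ, ∀ s ∈ closure B, ∀ t ∈ closure B, dist s t ≤ L * dist (Xbar s) (Xbar t)

/-- `K i k` is an element of the refined fluid mesh in which the gradient of a velocity is
evaluated at the image of the `k`-th node of the solid element `T i`: the image of the node lies in
the closure of the part of the image of `T i` that is interior to `K i k`. If the image of the node is
interior to a fluid element there is exactly one choice; on the edges of the fluid mesh, where the
gradient may jump, `K` fixes the one sided gradient. -/
def IsElementChoice {ιΩ ιB : Type} (vΩ : ιΩ → Fin 3 → Plane) (vB : ιB → Fin 3 → Plane)
    (Xbar : Plane → Plane) (Q : QuadRule) (K : ιB → Fin Q.num → ιΩ × Fin 4) : Prop :=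
  ∀ i k, Xbar (Q.nodeOn (vB i) k) ∈
    closure (Xbar '' interior (tri (vB i)) ∩ interior (tri (refine vΩ (K i k))))

section Coupling

variable {ιΩ ιB : Type} [Fintype ιB] {Ω B : Set Plane}
  {vΩ : ιΩ → Fin 3 → Plane} {vB : ιB → Fin 3 → Plane}

/-- The inexact coupling `c_{0,h}(μ_h, v_h(Xbar) - Y_h)`. -/
def c0h (Q₀ : QuadRule) (Xbar : Plane → Plane) (μ : SolidFun B vB)
    (v : FEFun Ω (refine vΩ) Plane) (Y : SolidFun B vB) : ℝ :=
  ∑ i, volume.real (tri (vB i)) * ∑ k, Q₀.weight k *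
    ⟪μ.toFun (Q₀.nodeOn (vB i) k),
      v.toFun (Xbar (Q₀.nodeOn (vB i) k)) - Y.toFun (Q₀.nodeOn (vB i) k)⟫_ℝ

/-- The quadrature of the gradient term, `∑_T |T| ∑ₖ ωₖ ∇μ_h(sₖ) : ∇(v_h(Xbar) - Y_h)(sₖ)`; the
gradient of `v_h(Xbar)` is `∇v_h(Xbar(sₖ)) ∇Xbar(sₖ)`, with `∇v_h` taken in the fluid element
`K i k` and `∇Xbar` in the solid element. -/
def gradh (Q₁ : QuadRule) (Xbar : Plane → Plane) (K : ιB → Fin Q₁.num → ιΩ × Fin 4)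
    (μ : SolidFun B vB) (v : FEFun Ω (refine vΩ) Plane) (Y : SolidFun B vB) : ℝ :=
  ∑ i, volume.real (tri (vB i)) * ∑ k, Q₁.weight k *
    (let s := Q₁.nodeOn (vB i) k
     frob (gradOn (vB i) μ.toFun s)
      ((gradOn (refine vΩ (K i k)) v.toFun (Xbar s)).comp (gradOn (vB i) Xbar s)
        - gradOn (vB i) Y.toFun s))

/-- The inexact coupling `c_{1,h}(μ_h, v_h(Xbar) - Y_h)`. -/
def c1h (Q₀ Q₁ : QuadRule) (Xbar : Plane → Plane) (K : ιB → Fin Q₁.num → ιΩ × Fin 4)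
    (μ : SolidFun B vB) (v : FEFun Ω (refine vΩ) Plane) (Y : SolidFun B vB) : ℝ :=
  c0h Q₀ Xbar μ v Y + gradh Q₁ Xbar K μ v Y

/-- The product norm `(‖v_h‖²_{1,Ω} + ‖Y_h‖²_{1,B})^{1/2}`. -/
def pairNorm (v : FEFun Ω (refine vΩ) Plane) (Y : SolidFun B vB) : ℝ :=
  Real.sqrt (‖v.toH1‖ ^ 2 + ‖Y.toH1‖ ^ 2)

/-- The supremum, in the extended reals, of `c(v_h, Y_h) / (‖v_h‖²_{1,Ω} + ‖Y_h‖²_{1,B})^{1/2}` over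
the nonzero pairs `(v_h, Y_h)` in `V_{0,h} × S_h`. -/
def supQuotient (c : FEFun Ω (refine vΩ) Plane → SolidFun B vB → ℝ) : EReal :=
  sSup {r : EReal | ∃ (v : FEFun Ω (refine vΩ) Plane) (Y : SolidFun B vB),
    IsDivFreeVelocity v ∧ 0 < pairNorm v Y ∧ r = ((c v Y / pairNorm v Y : ℝ) : EReal)}

/-- The norm of `μ_h` in the dual space of `H¹(B)²`, through `Y ↦ (μ_h, Y)_B`. -/
def normLambda0 (μ : SolidFun B vB) : ℝ := ‖l2Functional (H1.val μ.toH1)‖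

/-- The norm of `μ_h` in `H¹(B)²`. -/
def normLambda1 (μ : SolidFun B vB) : ℝ := ‖μ.toH1‖

end Coupling

end FSI

end

/-!
The infimum-supremum bound already holds with the velocity `v = 0`, so that neither the fluid mesh
nor the map `Xbar` nor the divergence constraint plays a role. On a solid triangle `μ · Y` is a
quadratic polynomial and `∇μ : ∇Y` is constant, so both quadratures are exact and
`c₀(μ, -Y) = -(μ, Y)_B`, `c₁(μ, -Y) = -(μ, Y)_{1,B}` (`c0h_zero_neg`, `c1h_zero_neg`). Replacing `Y` by
`-Y`, a real upper bound `M` of the supremum satisfies `(μ, Y)_B ≤ M ‖Y‖`, respectively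
`(μ, Y)_{1,B} ≤ M ‖Y‖`, for all finite element functions `Y`
(`le_mul_norm_of_supQuotient_le`).

For `ℓ = 1` the choice `Y = μ` gives `‖μ‖ ≤ M`. For `ℓ = 0` and an arbitrary `Y ∈ H¹(B)²`,
`(μ, Y)_B = (μ, ΠY)_B ≤ M ‖ΠY‖ ≤ C₀ M ‖Y‖`, whence `‖μ‖_{Λ₀} ≤ C₀ M` (`normLambda0_le`). Hence
`β₀ = min 1 C₀⁻¹` is admissible.

The exactness rests on three facts: the triangles cover `B` up to a null set and overlap in null sets
(`IsMesh.setIntegral_eq_sum`), the rules carry over from the reference triangle by an affine change of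
variables (`QuadRule.ExactOfDegree.integral_inner`), and the weak gradient of a finite element
function is on each triangle the gradient of its affine piece (`FEFun.grad_ae_eq`). The projection
`ΠY` exists because finite element functions span a finite dimensional subspace of `L²`
(`finiteDimensional_feL2`).
-/

noncomputable section

namespace FSI

/-! ### Geometry of triangles and meshes -/

theorem isCompact_tri (a : Fin 3 → Plane) : IsCompact (tri a) :=
  (finite_range a).isCompact_convexHull ℝ

theorem convex_tri (a : Fin 3 → Plane) : Convex ℝ (tri a) := convex_convexHull ℝ _

theorem measurableSet_tri (a : Fin 3 → Plane) : MeasurableSet (tri a) :=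
  (isCompact_tri a).isClosed.measurableSet

theorem affineSpan_range_eq_top {a : Fin 3 → Plane} (ha : AffineIndependent ℝ a) :
    affineSpan ℝ (range a) = ⊤ := by
  rw [ha.affineSpan_eq_top_iff_card_eq_finrank_add_one]
  simp

theorem interior_tri_nonempty {a : Fin 3 → Plane} (ha : AffineIndependent ℝ a) :
    (interior (tri a)).Nonempty :=
  interior_convexHull_nonempty_iff_affineSpan_eq_top.2 (affineSpan_range_eq_top ha)

theorem interior_tri_ae_eq (a : Fin 3 → Plane) :
    interior (tri a) =ᵐ[(volume : Measure Plane)] tri a :=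
  interior_ae_eq_of_null_frontier ((convex_tri a).addHaar_frontier volume)

section Mesh

variable {ι : Type} {D : Set Plane} {vert : ι → Fin 3 → Plane}

/-- Two triangles of a mesh meet in the convex hull of at most two vertices, hence in a set of
measure zero. -/
theorem IsMesh.aedisjoint (h : IsMesh D vert) :
    Pairwise (Function.onFun (AEDisjoint (volume : Measure Plane)) fun i => tri (vert i)) := by
  intro i j hij
  change volume (tri (vert i) ∩ tri (vert j)) = 0
  rw [h.conforming i j hij]
  obtain ⟨k, hk⟩ : ∃ k, vert i k ∉ range (vert j) := by
    by_contra! hall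
    have hsub : range (vert i) ⊆ range (vert j) := by
      rintro _ ⟨k, rfl⟩
      exact hall k
    refine h.distinct i j hij (eq_of_subset_of_ncard_le hsub ?_ (finite_range _))
    rw [← image_univ, ← image_univ, ncard_image_of_injective _ (h.nondegenerate i).injective,
      ncard_image_of_injective _ (h.nondegenerate j).injective]
  have hsub : convexHull ℝ (range (vert i) ∩ range (vert j)) ⊆
      affineSpan ℝ (vert i '' (univ \ {k})) := by
    refine (convexHull_mono ?_).trans (convexHull_subset_affineSpan _)
    rintro _ ⟨⟨l, rfl⟩, hl⟩
    refine ⟨l, ⟨trivial, ?_⟩, rfl⟩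
    rintro rfl
    exact hk hl
  refine measure_mono_null hsub (Measure.addHaar_affineSubspace volume _ ?_)
  intro htop
  refine (h.nondegenerate i).notMem_affineSpan_sdiff k univ ?_
  rw [htop]
  trivial

theorem IsMesh.isOpen (h : IsMesh D vert) : IsOpen D := h.interior_union ▸ isOpen_interior

theorem IsMesh.subset_iUnion (h : IsMesh D vert) : D ⊆ ⋃ i, tri (vert i) :=
  h.interior_union ▸ interior_subset

theorem IsMesh.interior_tri_subset (h : IsMesh D vert) (i : ι) : interior (tri (vert i)) ⊆ D := by
  rw [← h.interior_union]
  exact interior_mono (Set.subset_iUnion (fun i => tri (vert i)) i)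

variable [Fintype ι]

theorem IsMesh.ae_eq_iUnion (h : IsMesh D vert) :
    D =ᵐ[(volume : Measure Plane)] ⋃ i, tri (vert i) := by
  refine h.subset_iUnion.eventuallyLE.antisymm ?_
  have h1 : (⋃ i, interior (tri (vert i))) =ᵐ[(volume : Measure Plane)] ⋃ i, tri (vert i) :=
    Filter.EventuallyEq.countable_iUnion fun i => interior_tri_ae_eq _
  exact h1.symm.le.trans (iUnion_subset h.interior_tri_subset).eventuallyLE

theorem IsMesh.measure_lt_top (h : IsMesh D vert) : volume D < ⊤ := by
  rw [measure_congr h.ae_eq_iUnion]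
  exact (isCompact_iUnion fun i => isCompact_tri _).measure_lt_top

theorem IsMesh.setIntegral_eq_sum (h : IsMesh D vert) {f : Plane → ℝ} (hf : IntegrableOn f D) :
    ∫ x in D, f x = ∑ i, ∫ x in tri (vert i), f x := by
  rw [setIntegral_congr_set h.ae_eq_iUnion, integral_iUnion_ae
    (fun i => (measurableSet_tri _).nullMeasurableSet) h.aedisjoint
    (hf.congr_set_ae h.ae_eq_iUnion.symm), tsum_fintype]

end Mesh

/-! ### Quadrature -/

theorem hasFDerivAt_affineMap {F : Type*} [NormedAddCommGroup F] [NormedSpace ℝ F]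
    (A : Plane →ᵃ[ℝ] F) (x : Plane) :
    HasFDerivAt A (LinearMap.toContinuousLinearMap A.linear) x :=
  (ContinuousAffineMap.mk A A.continuous_of_finiteDimensional).hasFDerivAt

/-- The affine map from the reference triangle onto the triangle with vertices `a`. -/
def refMap (a : Fin 3 → Plane) : Plane →ᵃ[ℝ] Plane :=
  (((EuclideanSpace.proj 0 : Plane →L[ℝ] ℝ).smulRight (a 1 - a 0) +
    (EuclideanSpace.proj 1 : Plane →L[ℝ] ℝ).smulRight (a 2 - a 0) : Plane →L[ℝ] Plane) :
      Plane →ₗ[ℝ] Plane).toAffineMap + AffineMap.const ℝ Plane (a 0)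

theorem refMap_apply (a : Fin 3 → Plane) (x : Plane) :
    refMap a x = a 0 + x 0 • (a 1 - a 0) + x 1 • (a 2 - a 0) := by
  simp [refMap]
  abel

theorem refMap_refVert (a : Fin 3 → Plane) (i : Fin 3) : refMap a (refVert i) = a i := by
  rw [refMap_apply]
  fin_cases i <;> simp [refVert, unitVec]

theorem refMap_image_tri (a : Fin 3 → Plane) : refMap a '' tri refVert = tri a := by
  rw [tri, AffineMap.image_convexHull, ← range_comp]
  congr 2
  funext i
  exact refMap_refVert a i

theorem refMap_injective {a : Fin 3 → Plane} (ha : AffineIndependent ℝ a) :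
    Function.Injective (refMap a) := by
  have hsurj : Function.Surjective (refMap a) := by
    have hle : affineSpan ℝ (range a) ≤ (⊤ : AffineSubspace ℝ Plane).map (refMap a) := by
      rw [affineSpan_le]
      rintro _ ⟨i, rfl⟩
      exact ⟨refVert i, trivial, refMap_refVert a i⟩
    intro y
    obtain ⟨x, -, hx⟩ := hle (affineSpan_range_eq_top ha ▸ AffineSubspace.mem_top ℝ Plane y)
    exact ⟨x, hx⟩
  rw [← AffineMap.linear_injective_iff]
  exact LinearMap.injective_iff_surjective.2 ((AffineMap.linear_surjective_iff _).2 hsurj)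

theorem QuadRule.nodeOn_eq (Q : QuadRule) (a : Fin 3 → Plane) (k : Fin Q.num) :
    Q.nodeOn a k = refMap a (Q.node k) :=
  (refMap_apply _ _).symm

theorem QuadRule.nodeOn_mem (Q : QuadRule) (a : Fin 3 → Plane) (k : Fin Q.num) :
    Q.nodeOn a k ∈ tri a := by
  rw [Q.nodeOn_eq, ← refMap_image_tri a]
  exact mem_image_of_mem _ (Q.node_mem k)

/-- Change of variables from the triangle with vertices `a` to the reference triangle. -/
theorem integral_tri_eq {a : Fin 3 → Plane} (ha : AffineIndependent ℝ a) (g : Plane → ℝ) :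
    ∫ x in tri a, g x =
      |LinearMap.det (refMap a).linear| * ∫ x in tri refVert, g (refMap a x) := by
  have hd : ∀ x ∈ tri refVert,
      HasFDerivWithinAt (refMap a) (LinearMap.toContinuousLinearMap (refMap a).linear)
        (tri refVert) x := fun x _ =>
    (hasFDerivAt_affineMap (refMap a) x).hasFDerivWithinAt
  rw [← refMap_image_tri a, integral_image_eq_integral_abs_det_fderiv_smul volume
    (measurableSet_tri _) hd (refMap_injective ha).injOn, ← integral_const_mul]
  rfl

theorem volume_real_tri {a : Fin 3 → Plane} (ha : AffineIndependent ℝ a) :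
    volume.real (tri a) = |LinearMap.det (refMap a).linear| * volume.real (tri refVert) := by
  simpa using integral_tri_eq ha fun _ => 1

/-- A coordinate of an affine map of the plane is a polynomial of degree at most one. -/
theorem exists_mvPolynomial_eval_eq (A : Plane →ᵃ[ℝ] Plane) (j : Fin 2) :
    ∃ p : MvPolynomial (Fin 2) ℝ, p.totalDegree ≤ 1 ∧
      ∀ x : Plane, MvPolynomial.eval (fun i => x i) p = A x j := by
  refine ⟨MvPolynomial.C (A 0 j) +
    ∑ i, MvPolynomial.C (A.linear (unitVec i) j) * MvPolynomial.X i, ?_, ?_⟩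
  · refine (MvPolynomial.totalDegree_add _ _).trans (max_le (by simp) ?_)
    refine MvPolynomial.totalDegree_finsetSum_le fun i _ => ?_
    refine (MvPolynomial.totalDegree_mul _ _).trans ?_
    simp
  · intro x
    have hx : x = ∑ i, x i • unitVec i := by
      ext l
      fin_cases l <;> simp [unitVec, Fin.sum_univ_two]
    have hA : A x = A.linear x + A 0 := by
      simpa using A.map_vadd 0 x
    rw [hA]
    conv_rhs => rw [hx]
    simp only [map_smul, Fin.sum_univ_two, map_add, map_mul, MvPolynomial.eval_C,
      MvPolynomial.eval_X, PiLp.add_apply, PiLp.smul_apply, smul_eq_mul]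
    ring

theorem QuadRule.ExactOfDegree.integral_inner {Q : QuadRule} (hQ : Q.ExactOfDegree 2)
    {a : Fin 3 → Plane} (ha : AffineIndependent ℝ a) (A B : Plane →ᵃ[ℝ] Plane) :
    ∫ x in tri a, ⟪A x, B x⟫_ℝ =
      volume.real (tri a) * ∑ k, Q.weight k * ⟪A (Q.nodeOn a k), B (Q.nodeOn a k)⟫_ℝ := by
  choose p hp1 hp2 using exists_mvPolynomial_eval_eq (A.comp (refMap a))
  choose q hq1 hq2 using exists_mvPolynomial_eval_eq (B.comp (refMap a))
  have key := hQ (∑ j, p j * q j) (MvPolynomial.totalDegree_finsetSum_le fun j _ =>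
    (MvPolynomial.totalDegree_mul _ _).trans (add_le_add (hp1 j) (hq1 j)))
  have heval : ∀ x : Plane, MvPolynomial.eval (fun i => x i) (∑ j, p j * q j) =
      ⟪A (refMap a x), B (refMap a x)⟫_ℝ := by
    intro x
    simp only [map_sum, map_mul, hp2, hq2, PiLp.inner_apply]
    exact Finset.sum_congr rfl fun j _ => by simp [mul_comm]
  simp only [heval] at key
  rw [integral_tri_eq ha, key, volume_real_tri ha]
  simp only [Q.nodeOn_eq]
  ring

theorem volume_real_tri_pos {a : Fin 3 → Plane} (ha : AffineIndependent ℝ a) :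
    0 < volume.real (tri a) :=
  ENNReal.toReal_pos ((isOpen_interior.measure_pos volume (interior_tri_nonempty ha)).trans_le
    (measure_mono interior_subset)).ne' (isCompact_tri a).measure_lt_top.ne

/-- The weights of a rule that is exact for constants sum up to one. The reference triangle has
positive measure as soon as some nondegenerate triangle exists. -/
theorem QuadRule.ExactOfDegree.sum_weight {Q : QuadRule} (hQ : Q.ExactOfDegree 0)
    {a : Fin 3 → Plane} (ha : AffineIndependent ℝ a) : ∑ k, Q.weight k = 1 := by
  have h := hQ 1 (by simp)
  have hpos := volume_real_tri_pos ha
  rw [volume_real_tri ha] at hpos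
  have hne : volume.real (tri refVert) ≠ 0 := (pos_of_mul_pos_right hpos (abs_nonneg _)).ne'
  simp only [map_one, integral_const, MeasurableSet.univ, measureReal_restrict_apply, univ_inter,
    smul_eq_mul, mul_one] at h
  exact (mul_left_cancel₀ hne (by simpa using h)).symm

/-! ### Gradients of finite element functions -/

section Gradient

variable {F : Type} [NormedAddCommGroup F] [InnerProductSpace ℝ F]

/-- Integration by parts of an affine function against a test function. -/
theorem IsTestFun.integral_fderiv_smul_affineMap {D : Set Plane} {φ : Plane → ℝ}
    (h : IsTestFun D φ) (A : Plane →ᵃ[ℝ] F) (j : Fin 2) :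
    ∫ x, fderiv ℝ φ x (unitVec j) • A x = -∫ x, φ x • A.linear (unitVec j) := by
  have hA : Continuous A := A.continuous_of_finiteDimensional
  have hd : ∀ x, fderiv ℝ A x = LinearMap.toContinuousLinearMap A.linear := fun x =>
    (hasFDerivAt_affineMap A x).fderiv
  have hc : Continuous (fun x => fderiv ℝ φ x (unitVec j)) :=
    (h.smooth.continuous_fderiv (by simp)).clm_apply continuous_const
  have hs : HasCompactSupport (fun x => fderiv ℝ φ x (unitVec j)) :=
    h.compact.fderiv_apply (𝕜 := ℝ) (unitVec j)
  have hφ := h.smooth.continuous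
  have key := integral_smul_fderiv_eq_neg_fderiv_smul_of_integrable (μ := volume) (f := φ) (g := A)
    (v := unitVec j) ((hc.smul hA).integrable_of_hasCompactSupport hs.smul_right)
    (by
      simp only [hd]
      exact (hφ.smul continuous_const).integrable_of_hasCompactSupport h.compact.smul_right)
    ((hφ.smul hA).integrable_of_hasCompactSupport h.compact.smul_right)
    (fun x _ => (h.smooth.differentiable (by simp)) x)
    (fun x _ => (hasFDerivAt_affineMap A x).differentiableAt)
  simp only [hd, LinearMap.coe_toContinuousLinearMap'] at key
  rw [key, neg_neg]

variable {ι : Type} {D : Set Plane} {vert : ι → Fin 3 → Plane}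

/-- On the interior of a triangle the weak gradient of a finite element function is the constant
gradient of the affine function with which it agrees there. -/
theorem FEFun.grad_ae_eq [CompleteSpace F] (h : IsMesh D vert) (u : FEFun D vert F) {i : ι}
    {A : Plane →ᵃ[ℝ] F} (hA : EqOn u.toFun A (tri (vert i))) (j : Fin 2) :
    ∀ᵐ x, x ∈ interior (tri (vert i)) → H1.grad u.toH1 x j = A.linear (unitVec j) := by
  set U := interior (tri (vert i)) with hU
  have hUD : U ⊆ D := h.interior_tri_subset i
  have hUfin : volume U < ⊤ := (measure_mono interior_subset).trans_lt
    (isCompact_tri (vert i)).measure_lt_top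
  have hG : MemLp (fun x => H1.grad u.toH1 x j) 2 (volume.restrict D) := memLp_grad_apply _ j
  have hloc : LocallyIntegrableOn
      (fun x => H1.grad u.toH1 x j - A.linear (unitVec j)) U volume := by
    have : IsFiniteMeasure ((volume : Measure Plane).restrict U) := ⟨by simpa using hUfin⟩
    have h1 : MemLp (fun x => H1.grad u.toH1 x j) 2 (volume.restrict U) :=
      hG.mono_measure (Measure.restrict_mono hUD le_rfl)
    exact IntegrableOn.locallyIntegrableOn
      ((h1.integrable (by norm_num)).sub (integrable_const _))
  have key := isOpen_interior.ae_eq_zero_of_integral_contDiff_smul_eq_zero (U := U) hloc ?_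
  · filter_upwards [key] with x hx hxU
    exact sub_eq_zero.1 (hx hxU)
  intro φ hφ1 hφ2 hφ3
  have hφ : IsTestFun D φ := ⟨hφ1, hφ2, hφ3.trans hUD⟩
  have hout : ∀ x, x ∉ U → φ x = 0 := fun x hx => image_eq_zero_of_notMem_tsupport
    fun hx' => hx (hφ3 hx')
  have hout' : ∀ x, x ∉ U → fderiv ℝ φ x (unitVec j) = 0 := by
    intro x hx
    rw [fderiv_of_notMem_tsupport (𝕜 := ℝ) fun hx' => hx (hφ3 hx')]
    rfl
  have e := u.toH1.2 φ hφ j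
  have e1 : ∫ x in D, fderiv ℝ φ x (unitVec j) • (u.toH1 : L2Pair D F).fst x =
      ∫ x, fderiv ℝ φ x (unitVec j) • A x := by
    rw [← setIntegral_eq_integral_of_forall_compl_eq_zero (μ := volume) (s := D)
      (f := fun x => fderiv ℝ φ x (unitVec j) • A x)
      (fun x hx => by rw [hout' x fun hx' => hx (hUD hx'), zero_smul])]
    refine integral_congr_ae ?_
    filter_upwards [u.isRep] with x hx
    by_cases hxU : x ∈ U
    · have hx' : (u.toH1 : L2Pair D F).fst x = u.toFun x := hx
      rw [hx', hA (interior_subset hxU)]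
    · simp [hout' x hxU]
  have e2 : ∫ x in D, φ x • (u.toH1 : L2Pair D F).snd x j =
      ∫ x, φ x • H1.grad u.toH1 x j :=
    setIntegral_eq_integral_of_forall_compl_eq_zero
      (fun x hx => by rw [hout x fun hx' => hx (hUD hx'), zero_smul])
  rw [e1, e2, hφ.integral_fderiv_smul_affineMap A j, neg_inj] at e
  have hint : Integrable fun x => φ x • H1.grad u.toH1 x j := by
    rw [← integrableOn_iff_integrable_of_support_subset (s := D)]
    · exact integrable_smul_L2 hφ.memLp hG
    · intro x hx
      by_contra hxD
      exact hx (by simp [hout x fun hx' => hxD (hUD hx')])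
  have hint' : Integrable fun x => φ x • A.linear (unitVec j) :=
    (hφ1.continuous.smul continuous_const).integrable_of_hasCompactSupport hφ2.smul_right
  simp only [smul_sub]
  rw [integral_sub hint hint', e, sub_self]

theorem uniqueDiffWithinAt_tri {a : Fin 3 → Plane} (ha : AffineIndependent ℝ a) {x : Plane}
    (hx : x ∈ tri a) : UniqueDiffWithinAt ℝ (tri a) x :=
  uniqueDiffWithinAt_convex (convex_tri a) (interior_tri_nonempty ha) (subset_closure hx)

theorem gradOn_eq {a : Fin 3 → Plane} (ha : AffineIndependent ℝ a) {w : Plane → Plane}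
    {A : Plane →ᵃ[ℝ] Plane} (hA : EqOn w A (tri a)) {x : Plane} (hx : x ∈ tri a) :
    gradOn a w x = LinearMap.toContinuousLinearMap A.linear := by
  rw [gradOn, fderivWithin_congr hA (hA hx)]
  exact (hasFDerivAt_affineMap A x).hasFDerivWithinAt.fderivWithin
    (uniqueDiffWithinAt_tri ha hx)

end Gradient

/-! ### Exact quadrature of the inner products -/

section Inner

variable {ι : Type} [Fintype ι] {D : Set Plane} {vert : ι → Fin 3 → Plane}

theorem QuadRule.ExactOfDegree.sum_eq_inner_val {Q : QuadRule} (hQ : Q.ExactOfDegree 2)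
    (h : IsMesh D vert) (u w : SolidFun D vert) :
    ∑ i, volume.real (tri (vert i)) * ∑ k, Q.weight k *
        ⟪u.toFun (Q.nodeOn (vert i) k), w.toFun (Q.nodeOn (vert i) k)⟫_ℝ =
      ⟪H1.val u.toH1, H1.val w.toH1⟫_ℝ := by
  rw [L2.inner_def, h.setIntegral_eq_sum (L2.integrable_inner _ _)]
  refine Finset.sum_congr rfl fun i _ => ?_
  obtain ⟨A, hA⟩ := u.affineOn i
  obtain ⟨B, hB⟩ := w.affineOn i
  have e : ∫ x in tri (vert i), ⟪H1.val u.toH1 x, H1.val w.toH1 x⟫_ℝ =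
      ∫ x in tri (vert i), ⟪A x, B x⟫_ℝ := by
    rw [← setIntegral_congr_set (interior_tri_ae_eq _),
      ← setIntegral_congr_set (interior_tri_ae_eq _)]
    refine integral_congr_ae ?_
    have hsub := h.interior_tri_subset i
    filter_upwards [ae_restrict_of_ae_restrict_of_subset hsub u.isRep,
      ae_restrict_of_ae_restrict_of_subset hsub w.isRep,
      ae_restrict_mem isOpen_interior.measurableSet] with x hx1 hx2 hx
    rw [hx1, hx2, hA (interior_subset hx), hB (interior_subset hx)]
  rw [e, hQ.integral_inner (h.nondegenerate i)]
  congr 1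
  refine Finset.sum_congr rfl fun k _ => ?_
  rw [hA (Q.nodeOn_mem _ k), hB (Q.nodeOn_mem _ k)]

theorem QuadRule.ExactOfDegree.sum_eq_inner_grad {Q : QuadRule} (hQ : Q.ExactOfDegree 0)
    (h : IsMesh D vert) (u w : SolidFun D vert) :
    ∑ i, volume.real (tri (vert i)) * ∑ k, Q.weight k *
        frob (gradOn (vert i) u.toFun (Q.nodeOn (vert i) k))
          (gradOn (vert i) w.toFun (Q.nodeOn (vert i) k)) =
      ⟪H1.grad u.toH1, H1.grad w.toH1⟫_ℝ := by
  rw [L2.inner_def, h.setIntegral_eq_sum (L2.integrable_inner _ _)]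
  refine Finset.sum_congr rfl fun i _ => ?_
  obtain ⟨A, hA⟩ := u.affineOn i
  obtain ⟨B, hB⟩ := w.affineOn i
  have e : ∫ x in tri (vert i), ⟪H1.grad u.toH1 x, H1.grad w.toH1 x⟫_ℝ =
      ∫ x in tri (vert i), ∑ j : Fin 2, ⟪A.linear (unitVec j), B.linear (unitVec j)⟫_ℝ := by
    rw [← setIntegral_congr_set (interior_tri_ae_eq _),
      ← setIntegral_congr_set (interior_tri_ae_eq _)]
    refine integral_congr_ae ?_
    filter_upwards [ae_restrict_of_ae (ae_all_iff.2 fun j => u.grad_ae_eq h hA j),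
      ae_restrict_of_ae (ae_all_iff.2 fun j => w.grad_ae_eq h hB j),
      ae_restrict_mem isOpen_interior.measurableSet] with x hx1 hx2 hx
    rw [PiLp.inner_apply]
    exact Finset.sum_congr rfl fun j _ => by rw [hx1 j hx, hx2 j hx]
  rw [e]
  simp only [gradOn_eq (h.nondegenerate i) hA (Q.nodeOn_mem _ _),
    gradOn_eq (h.nondegenerate i) hB (Q.nodeOn_mem _ _), ← Finset.sum_mul,
    hQ.sum_weight (h.nondegenerate i), frob, one_mul]
  simp

theorem H1.inner_eq {F : Type} [NormedAddCommGroup F] [InnerProductSpace ℝ F] (u w : H1 D F) :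
    ⟪u, w⟫_ℝ = ⟪H1.val u, H1.val w⟫_ℝ + ⟪H1.grad u, H1.grad w⟫_ℝ :=
  WithLp.prod_inner_apply (𝕜 := ℝ) (u : L2Pair D F) (w : L2Pair D F)

end Inner

/-! ### The space of finite element functions -/

section Space

variable {ι : Type} (D : Set Plane) (vert : ι → Fin 3 → Plane)
  (F : Type) [NormedAddCommGroup F] [InnerProductSpace ℝ F]

/-- The finite element functions as a linear space of pairs: a pointwise representative on the whole
plane, and the `H¹` function that it represents. -/
def feSubmodule : Submodule ℝ ((Plane → F) × H1 D F) where
  carrier := {p | H1.val p.2 =ᵐ[(volume : Measure Plane).restrict D] p.1 ∧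
    ∀ i, ∃ A : Plane →ᵃ[ℝ] F, EqOn p.1 A (tri (vert i))}
  zero_mem' := ⟨Lp.coeFn_zero _ _ _, fun i => ⟨0, fun _ _ => rfl⟩⟩
  add_mem' := by
    rintro p q ⟨hp, hp'⟩ ⟨hq, hq'⟩
    refine ⟨(Lp.coeFn_add (H1.val p.2) (H1.val q.2)).trans (hp.add hq), fun i => ?_⟩
    obtain ⟨A, hA⟩ := hp' i
    obtain ⟨B, hB⟩ := hq' i
    exact ⟨A + B, fun x hx => congrArg₂ (· + ·) (hA hx) (hB hx)⟩
  smul_mem' := by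
    rintro c p ⟨hp, hp'⟩
    refine ⟨(Lp.coeFn_smul c (H1.val p.2)).trans (hp.const_smul c), fun i => ?_⟩
    obtain ⟨A, hA⟩ := hp' i
    exact ⟨c • A, fun x hx => congrArg (c • ·) (hA hx)⟩

variable {D vert F}

/-- The finite element function given by an element of `feSubmodule`. -/
def FEFun.ofMem {p : (Plane → F) × H1 D F} (hp : p ∈ feSubmodule D vert F) : FEFun D vert F :=
  ⟨p.1, p.2, hp.1, hp.2⟩

theorem FEFun.mem (u : FEFun D vert F) : (u.toFun, u.toH1) ∈ feSubmodule D vert F :=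
  ⟨u.isRep, u.affineOn⟩

/-- The negative of a finite element function. -/
def FEFun.neg (u : FEFun D vert F) : FEFun D vert F :=
  FEFun.ofMem (neg_mem u.mem)

variable (D vert F) in
/-- The zero finite element function. -/
def FEFun.zero : FEFun D vert F :=
  FEFun.ofMem (zero_mem _)

/-- The subspace of `L²` formed by the finite element functions. -/
def feL2 (D : Set Plane) (vert : ι → Fin 3 → Plane) (F : Type) [NormedAddCommGroup F]
    [InnerProductSpace ℝ F] : Submodule ℝ (L2 D F) :=
  (feSubmodule D vert F).map ((H1.toL2 D F : H1 D F →ₗ[ℝ] L2 D F).comp (LinearMap.snd ℝ _ _))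

/-- A finite element function is determined by its values at the vertices of the mesh. -/
theorem finiteDimensional_feL2 [FiniteDimensional ℝ F] [Fintype ι] (h : IsMesh D vert) :
    FiniteDimensional ℝ (feL2 D vert F) := by
  let g : feSubmodule D vert F →ₗ[ℝ] L2 D F :=
    ((H1.toL2 D F : H1 D F →ₗ[ℝ] L2 D F).comp (LinearMap.snd ℝ _ _)).comp
      (feSubmodule D vert F).subtype
  let T : feSubmodule D vert F →ₗ[ℝ] (ι → Fin 3 → F) :=
    { toFun := fun p i k => p.1.1 (vert i k)
      map_add' := fun _ _ => rfl
      map_smul' := fun _ _ => rfl }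
  have hker : LinearMap.ker T ≤ LinearMap.ker g := by
    intro p hp
    have hp0 : ∀ i, EqOn p.1.1 0 (tri (vert i)) := by
      intro i
      obtain ⟨A, hA⟩ := p.2.2 i
      have hA0 : ∀ k, A (vert i k) = 0 := fun k => by
        rw [← hA (subset_convexHull ℝ _ (mem_range_self k))]
        exact congrFun (congrFun (LinearMap.mem_ker.1 hp) i) k
      have himg : A '' tri (vert i) ⊆ {0} := by
        rw [tri, AffineMap.image_convexHull]
        refine convexHull_min ?_ (convex_singleton 0)
        rintro _ ⟨_, ⟨k, rfl⟩, rfl⟩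
        exact hA0 k
      intro x hx
      rw [hA hx]
      exact himg (mem_image_of_mem _ hx)
    refine LinearMap.mem_ker.2 ((Lp.eq_zero_iff_ae_eq_zero).2 ?_)
    filter_upwards [p.2.1, ae_restrict_mem h.isOpen.measurableSet] with x hx hxD
    obtain ⟨i, hi⟩ := mem_iUnion.1 (h.subset_iUnion hxD)
    exact hx.trans (hp0 i hi)
  have hfin : FiniteDimensional ℝ (feSubmodule D vert F ⧸ LinearMap.ker T) :=
    Module.Finite.equiv T.quotKerEquivRange.symm
  have hrange : feL2 D vert F = LinearMap.range ((LinearMap.ker T).liftQ g hker) := by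
    rw [Submodule.range_liftQ, LinearMap.range_comp, Submodule.range_subtype]
    rfl
  rw [hrange]
  infer_instance

theorem exists_isL2Projection [Fintype ι] (h : IsMesh D vert) (Y : H1 D Plane) :
    ∃ P : SolidFun D vert, IsL2Projection Y P := by
  have := finiteDimensional_feL2 (F := Plane) h
  obtain ⟨p, hp, hpY⟩ := ((feL2 D vert Plane).starProjection_apply_mem (H1.val Y))
  refine ⟨FEFun.ofMem hp, fun Z => ?_⟩
  have key := Submodule.starProjection_inner_eq_zero (K := feL2 D vert Plane) (H1.val Y)
    (H1.val Z.toH1) ⟨_, Z.mem, rfl⟩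
  rw [← hpY] at key
  exact key

theorem exists_toFun_eq_const [CompleteSpace F] [Fintype ι] (h : IsMesh D vert) (c : F) :
    ∃ u : FEFun D vert F, u.toFun = fun _ => c := by
  have : IsFiniteMeasure ((volume : Measure Plane).restrict D) :=
    ⟨by simpa using h.measure_lt_top⟩
  have hc : MemLp (fun _ : Plane => c) 2 ((volume : Measure Plane).restrict D) := memLp_const c
  have hmem : WithLp.toLp 2 (hc.toLp (fun _ => c), (0 : L2 D (GradVal F))) ∈ H1 D F := by
    intro φ hφ j
    have e1 : ∫ x in D, fderiv ℝ φ x (unitVec j) • (hc.toLp (fun _ => c)) x = 0 := by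
      have hout : ∀ x, x ∉ D → fderiv ℝ φ x (unitVec j) • c = 0 := by
        intro x hx
        rw [fderiv_of_notMem_tsupport (𝕜 := ℝ) fun hx' => hx (hφ.support hx')]
        simp
      have e := hφ.integral_fderiv_smul_affineMap (AffineMap.const ℝ Plane c) j
      simp only [AffineMap.const_apply, AffineMap.const_linear, LinearMap.zero_apply, smul_zero,
        integral_zero, neg_zero] at e
      rw [← e, ← setIntegral_eq_integral_of_forall_compl_eq_zero hout]
      refine integral_congr_ae ?_
      filter_upwards [hc.coeFn_toLp] with x hx
      rw [hx]
    have e2 : ∫ x in D, φ x • (0 : L2 D (GradVal F)) x j = 0 := by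
      rw [← integral_zero Plane F (μ := (volume : Measure Plane).restrict D)]
      refine integral_congr_ae ?_
      filter_upwards [Lp.coeFn_zero (GradVal F) 2 ((volume : Measure Plane).restrict D)] with x hx
      rw [hx]
      simp
    exact e1.trans ((congrArg Neg.neg e2).trans neg_zero).symm
  exact ⟨⟨fun _ => c, ⟨_, hmem⟩, hc.coeFn_toLp, fun i => ⟨AffineMap.const ℝ Plane c,
    fun _ _ => rfl⟩⟩, rfl⟩

/-- A nonzero constant function: it supplies a nonzero pair, so that the supremum is not taken over
the empty set. -/
theorem exists_norm_toH1_pos [Fintype ι] (h : IsMesh D vert) (hD : D.Nonempty) :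
    ∃ u : SolidFun D vert, 0 < ‖u.toH1‖ := by
  obtain ⟨u, hu⟩ := exists_toFun_eq_const h (unitVec 0)
  refine ⟨u, norm_pos_iff.2 fun h0 => ?_⟩
  have hrep := u.isRep
  rw [h0, hu] at hrep
  have hz : ∀ᵐ _ : Plane ∂(volume : Measure Plane).restrict D, False := by
    filter_upwards [hrep, Lp.coeFn_zero Plane 2 ((volume : Measure Plane).restrict D)] with x hx hx'
    have h1 : unitVec 0 = (0 : Plane) := hx.symm.trans hx'
    simp [unitVec] at h1
  rw [ae_iff] at hz
  simp only [not_false_eq_true, Set.ofPred_true, Measure.restrict_apply_univ] at hz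
  exact (h.isOpen.measure_pos volume hD).ne' hz

end Space

/-! ### The inf-sup estimates -/

section InfSup

variable {ιΩ ιB : Type} [Fintype ιB] {Ω B : Set Plane}
  {vΩ : ιΩ → Fin 3 → Plane} {vB : ιB → Fin 3 → Plane}

theorem isDivFreeVelocity_zero :
    IsDivFreeVelocity (FEFun.zero Ω (refine vΩ) Plane) where
  zeroTrace := subset_closure ⟨0, ⟨contDiff_const, HasCompactSupport.zero, by simp⟩,
    Lp.coeFn_zero _ _ _⟩
  divFree q _ := by
    rw [← integral_zero Plane ℝ (μ := (volume : Measure Plane).restrict Ω)]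
    refine integral_congr_ae ?_
    filter_upwards [Lp.coeFn_zero (GradVal Plane) 2 ((volume : Measure Plane).restrict Ω)] with x hx
    have hx' : H1.grad (FEFun.zero Ω (refine vΩ) Plane).toH1 x = 0 := hx
    simp [hx']

theorem c0h_zero_neg {Q₀ : QuadRule} (hQ₀ : Q₀.ExactOfDegree 2) (hB : IsMesh B vB)
    (Xbar : Plane → Plane) (μ Y : SolidFun B vB) :
    c0h Q₀ Xbar μ (FEFun.zero Ω (refine vΩ) Plane) Y.neg = ⟪H1.val μ.toH1, H1.val Y.toH1⟫_ℝ := by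
  rw [← hQ₀.sum_eq_inner_val hB]
  simp [c0h, FEFun.zero, FEFun.neg, FEFun.ofMem]

theorem gradh_zero_neg {Q₁ : QuadRule} (hQ₁ : Q₁.ExactOfDegree 0) (hB : IsMesh B vB)
    (Xbar : Plane → Plane) (K : ιB → Fin Q₁.num → ιΩ × Fin 4) (μ Y : SolidFun B vB) :
    gradh Q₁ Xbar K μ (FEFun.zero Ω (refine vΩ) Plane) Y.neg =
      ⟪H1.grad μ.toH1, H1.grad Y.toH1⟫_ℝ := by
  rw [← hQ₁.sum_eq_inner_grad hB]
  have hneg : ∀ i k, fderivWithin ℝ (-Y.toFun) (tri (vB i)) (Q₁.nodeOn (vB i) k) =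
      -fderivWithin ℝ Y.toFun (tri (vB i)) (Q₁.nodeOn (vB i) k) := fun i k =>
    fderivWithin_neg (uniqueDiffWithinAt_tri (hB.nondegenerate i) (Q₁.nodeOn_mem _ k))
  simp [gradh, gradOn, FEFun.zero, FEFun.neg, FEFun.ofMem, hneg]

theorem c1h_zero_neg {Q₀ Q₁ : QuadRule} (hQ₀ : Q₀.ExactOfDegree 2) (hQ₁ : Q₁.ExactOfDegree 0)
    (hB : IsMesh B vB) (Xbar : Plane → Plane) (K : ιB → Fin Q₁.num → ιΩ × Fin 4)
    (μ Y : SolidFun B vB) :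
    c1h Q₀ Q₁ Xbar K μ (FEFun.zero Ω (refine vΩ) Plane) Y.neg = ⟪μ.toH1, Y.toH1⟫_ℝ := by
  rw [c1h, c0h_zero_neg hQ₀ hB, gradh_zero_neg hQ₁ hB, H1.inner_eq]

/-- If `c (0, -Y)` is a linear functional `b` of `Y`, then every real upper bound of the supremum is
nonnegative and bounds the norm of `b` on the solid finite element space. -/
theorem le_mul_norm_of_supQuotient_le (hB : IsMesh B vB) (hne : B.Nonempty)
    {c : FEFun Ω (refine vΩ) Plane → SolidFun B vB → ℝ} {b : H1 B Plane →ₗ[ℝ] ℝ}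
    (hc : ∀ Y : SolidFun B vB, c (FEFun.zero Ω (refine vΩ) Plane) Y.neg = b Y.toH1) {M : ℝ}
    (hM : supQuotient c ≤ M) :
    0 ≤ M ∧ ∀ Y : SolidFun B vB, b Y.toH1 ≤ M * ‖Y.toH1‖ := by
  have key : ∀ Y : SolidFun B vB, b Y.toH1 ≤ M * ‖Y.toH1‖ := by
    intro Y
    rcases (norm_nonneg Y.toH1).eq_or_lt with h0 | hpos
    · rw [norm_eq_zero.1 h0.symm]
      simp
    · have hnorm : pairNorm (FEFun.zero Ω (refine vΩ) Plane) Y.neg = ‖Y.toH1‖ := by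
        simp [pairNorm, FEFun.zero, FEFun.neg, FEFun.ofMem]
      have hle : ((b Y.toH1 / ‖Y.toH1‖ : ℝ) : EReal) ≤ M :=
        (sSup_le_iff.1 hM) _ ⟨FEFun.zero Ω (refine vΩ) Plane, Y.neg, isDivFreeVelocity_zero,
          by rwa [hnorm], by rw [hnorm, hc]⟩
      exact (div_le_iff₀ hpos).1 (EReal.coe_le_coe_iff.1 hle)
  refine ⟨?_, key⟩
  -- Testing with `u` and with `-u` excludes a negative bound, also when `b` vanishes.
  obtain ⟨u, hu⟩ := exists_norm_toH1_pos hB hne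
  have h1 := key u
  have h2 := key u.neg
  have h3 : u.neg.toH1 = -u.toH1 := rfl
  rw [h3, map_neg, norm_neg] at h2
  nlinarith

/-- To bound the supremum from below by `r` it suffices to show `r ≤ M` for all `M ≥ 0` that bound the
norm of `b` on the solid finite element space. -/
theorem coe_le_supQuotient (hB : IsMesh B vB) (hne : B.Nonempty)
    {c : FEFun Ω (refine vΩ) Plane → SolidFun B vB → ℝ} {b : H1 B Plane →ₗ[ℝ] ℝ}
    (hc : ∀ Y : SolidFun B vB, c (FEFun.zero Ω (refine vΩ) Plane) Y.neg = b Y.toH1) {r : ℝ}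
    (hr : ∀ M : ℝ, 0 ≤ M → (∀ Y : SolidFun B vB, b Y.toH1 ≤ M * ‖Y.toH1‖) → r ≤ M) :
    (r : EReal) ≤ supQuotient c := by
  refine EReal.le_of_forall_lt_iff_le.1 fun M hM => ?_
  obtain ⟨h0, hle⟩ := le_mul_norm_of_supQuotient_le hB hne hc hM.le
  exact EReal.coe_le_coe_iff.2 (hr M h0 hle)

/-- The `L²` projection replaces the test function `Y ∈ H¹(B)²` in the dual norm by a finite element
function, at the price of the stability constant. -/
theorem normLambda0_le (hB : IsMesh B vB) {C₀ : ℝ} (hC₀ : 0 < C₀)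
    (hstab : H1StableProjection B vB C₀) (μ : SolidFun B vB) {M : ℝ} (hM : 0 ≤ M)
    (hle : ∀ Y : SolidFun B vB, ⟪H1.val μ.toH1, H1.val Y.toH1⟫_ℝ ≤ M * ‖Y.toH1‖) :
    normLambda0 μ ≤ C₀ * M := by
  have key : ∀ Y : H1 B Plane, l2Functional (H1.val μ.toH1) Y ≤ C₀ * M * ‖Y‖ := by
    intro Y
    obtain ⟨P, hP⟩ := exists_isL2Projection hB Y
    have h1 := hP μ
    rw [inner_sub_left, sub_eq_zero, real_inner_comm, real_inner_comm (H1.val μ.toH1)] at h1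
    calc l2Functional (H1.val μ.toH1) Y = ⟪H1.val μ.toH1, H1.val P.toH1⟫_ℝ := h1
      _ ≤ M * ‖P.toH1‖ := hle P
      _ ≤ M * (C₀ * ‖Y‖) := mul_le_mul_of_nonneg_left (hstab Y P hP) hM
      _ = C₀ * M * ‖Y‖ := by ring
  refine ContinuousLinearMap.opNorm_le_bound _ (by positivity) fun Y => ?_
  rw [Real.norm_eq_abs, abs_le']
  refine ⟨key Y, ?_⟩
  simpa using key (-Y)

end InfSup

end FSI

end

theorem mainTheorem10 (C₀ : ℝ) (hC₀ : 0 < C₀) :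
    ∃ β₀ : ℝ, 0 < β₀ ∧
      ∀ (ιΩ ιB : Type) [Fintype ιΩ] [Fintype ιB] (Ω B : Set FSI.Plane)
        (vΩ : ιΩ → Fin 3 → FSI.Plane) (vB : ιB → Fin 3 → FSI.Plane)
        (Xbar : FSI.Plane → FSI.Plane) (Q₀ Q₁ : FSI.QuadRule)
        (K : ιB → Fin Q₁.num → ιΩ × Fin 4),
        FSI.IsMesh Ω vΩ → FSI.IsMesh B vB → B.Nonempty →
        FSI.IsSolidMap Ω B Xbar →
        Q₀.ExactOfDegree 2 → Q₁.ExactOfDegree 0 →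
        FSI.IsElementChoice vΩ vB Xbar Q₁ K →
        FSI.H1StableProjection B vB C₀ →
        ∀ μ : FSI.SolidFun B vB,
          ((β₀ * FSI.normLambda0 μ : ℝ) : EReal) ≤
            FSI.supQuotient (Ω := Ω) (vΩ := vΩ)
              (fun v Y => FSI.c0h Q₀ Xbar μ v Y) ∧
          ((β₀ * FSI.normLambda1 μ : ℝ) : EReal) ≤
            FSI.supQuotient (Ω := Ω) (vΩ := vΩ)
              (fun v Y => FSI.c1h Q₀ Q₁ Xbar K μ v Y) := by
  refine ⟨min 1 C₀⁻¹, by positivity, ?_⟩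
  intro ιΩ ιB _ _ Ω B vΩ vB Xbar Q₀ Q₁ K _ hB hne _ hQ₀ hQ₁ _ hstab μ
  constructor
  · refine FSI.coe_le_supQuotient hB hne
      (b := (FSI.l2Functional (FSI.H1.val μ.toH1) : FSI.H1 B FSI.Plane →ₗ[ℝ] ℝ))
      (fun Y => FSI.c0h_zero_neg hQ₀ hB Xbar μ Y) fun M hM hle => ?_
    calc min 1 C₀⁻¹ * FSI.normLambda0 μ ≤ C₀⁻¹ * (C₀ * M) :=
          mul_le_mul (min_le_right _ _) (FSI.normLambda0_le hB hC₀ hstab μ hM hle)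
            (norm_nonneg (FSI.l2Functional (FSI.H1.val μ.toH1))) (by positivity)
      _ = M := inv_mul_cancel_left₀ hC₀.ne' M
  · refine FSI.coe_le_supQuotient hB hne (b := (innerSL ℝ μ.toH1 : FSI.H1 B FSI.Plane →ₗ[ℝ] ℝ))
      (fun Y => FSI.c1h_zero_neg hQ₀ hQ₁ hB Xbar K μ Y) fun M hM hle => ?_
    have h1 : ‖μ.toH1‖ * ‖μ.toH1‖ ≤ M * ‖μ.toH1‖ := by
      rw [← real_inner_self_eq_norm_mul_norm]
      exact hle μ
    have h2 : ‖μ.toH1‖ ≤ M := by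
      rcases (norm_nonneg μ.toH1).eq_or_lt with h0 | hpos
      · rwa [← h0]
      · exact le_of_mul_le_mul_right h1 hpos
    calc min 1 C₀⁻¹ * FSI.normLambda1 μ ≤ 1 * M :=
          mul_le_mul (min_le_left _ _) h2 (norm_nonneg _) zero_le_one
      _ = M := one_mul M
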